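/- A set $\Lambda\subset\mathbb{R}$ is called Delone if it is uniformly discrete (there is $r>0$ with $|x-y|\ge r$ for all distinct $x,y\in\Lambda$) and relatively dense (there is $R>0$ such that every ball of radius $R$ contains a point of $\Lambda$). A Delone set $\Lambda\subset\mathbb{R}$ is bounded distance equivalent to a lattice $L=\xi\mathbb{Z}$, $\xi>0$, if there are a constant $C>0$ and a bijection $g:\Lambda\to L$ such that $|x-g(x)|<C$ for all $x\in\Lambda$. Let $\varepsilon,\eta$ be irrational real numbers with $\varepsilon\in(0,1)$ and $\varepsilon\neq\eta$, and let $0\le c<d\le 1$. Then the set \[ \Sigma_{\varepsilon,\eta}\big([c,d)\big)=\{a+b\eta : a,b\in\mathbb{Z},\ c\le a+b\varepsilon<d\} \] is a Delone set, and it is bounded distance equivalent to some lattice if and only if $d-c\in\mathbb{Z}+\mathbb{Z}\varepsilon$. In that case it is bounded distance equivalent to the lattice $\frac{|\eta-\varepsilon|}{d-c}\mathbb{Z}$, and to no other lattice. -/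

import Mathlib

/-- A Delone set: uniformly discrete and relatively dense. Mathlib bundles the set together with
a choice of radii; this is the predicate on plain sets. -/
def IsDelone {E : Type*} [MetricSpace E] (Λ : Set E) : Prop :=
  ∃ D : Delone.DeloneSet E, (D : Set E) = Λ

/-- The bounded distance relation: some bijection between the two sets moves all points by less
than a fixed constant. -/
def BoundedDistEquiv {E : Type*} [MetricSpace E] (Λ Λ' : Set E) : Prop :=
  ∃ C : ℝ, 0 < C ∧ ∃ g : Λ ≃ Λ', ∀ x : Λ, dist (x : E) (g x : E) < C

/-- A full-rank lattice: a discrete additive subgroup that spans the space over the reals. -/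
def IsLattice {E : Type*} [NormedAddCommGroup E] [NormedSpace ℝ E] (L : Submodule ℤ E) : Prop :=
  ∃ _ : DiscreteTopology L, IsZLattice ℝ L

/-- The Delone set `Λ` is bounded distance equivalent to the lattice `L`. -/
def IsBDLTo {E : Type*} [NormedAddCommGroup E] [NormedSpace ℝ E] (Λ : Set E)
    (L : Submodule ℤ E) : Prop :=
  IsDelone Λ ∧ IsLattice L ∧ BoundedDistEquiv Λ (L : Set E)

/-- The Delone set `Λ` is bounded distance equivalent to a lattice. -/
def IsBDL {E : Type*} [NormedAddCommGroup E] [NormedSpace ℝ E] (Λ : Set E) : Prop :=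
  ∃ L : Submodule ℤ E, IsBDLTo Λ L

/-- The cut-and-project set with parameters `ε`, `η` and acceptance window `Ω`: all `a + b η` with
integers `a`, `b` such that `a + b ε` lies in `Ω`. -/
def cutAndProject (ε η : ℝ) (Ω : Set ℝ) : Set ℝ :=
  {x | ∃ a b : ℤ, x = a + b * η ∧ (a + b * ε : ℝ) ∈ Ω}

/-!
A point `a + bη` of `Σ = cutAndProject ε η [c, d)` comes from a lattice point `(a, b)` whose window
coordinate `y = a + bε` lies in `[c, d)`. It equals `y + b(η - ε)`, so up to a bounded error it is
`b(η - ε)`; write `ℓ = d - c`.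

*Sufficiency.* Let `ℓ = m + nε`. Translation of `ℤ²` by `(m, n)` shifts the window coordinate by
exactly `ℓ`, so the strip over `[c, d)` is a fundamental domain for it, and `Σ` is in bijection
with `ℤ² / ℤ(m, n)`. The linear form `mb - na = bℓ - ny` is invariant under the translation,
attains exactly the multiples of `g = gcd(m, n)`, each on `g` orbits, and is `bℓ` up to a bounded
error. Filling in the residues modulo `g` gives a bijection of `Σ` with `ℤ`
(`exists_stripEquiv_int`) which, multiplied by `(η - ε) / ℓ`, moves points by a bounded amount
(`boundedDistEquiv_cutAndProject`).

*Necessity.* As `ℓ ≤ 1`, the second coordinates `b` of the strip are the times at which the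
rotation by `ε`, started at `-c`, visits the arc `[0, ℓ)` of the circle. A bounded distance
equivalence of `Σ` with a lattice `ξℤ` makes the number of visits during any `N` consecutive times
equal to `Nθ + O(1)`, where `θ = |η - ε| / ξ` (`abs_card_sub_mul_le`). By density of the orbit,
the Birkhoff sums of `f = 1_[0,ℓ) - θ` are bounded uniformly over the whole circle
(`exists_birkhoffSum_arc_eq`). Their upper limit `h` is bounded, measurable and satisfies
`h(x + ε) = h(x) - f(x)` (`exists_transfer_of_birkhoffSum_bounded`). Integration gives `θ = ℓ`.
Moreover `exp(2πih)` is an eigenfunction of the rotation with eigenvalue `exp(2πiθ)`, and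
comparing Fourier coefficients yields `θ ∈ ℤ + ℤε` (`exists_eq_add_mul_of_birkhoffSum_bounded`).

*Uniqueness.* Two lattices in bounded distance of the same set have the same density
(`le_of_injective_of_abs_sub_le`).
-/

/-! ### Lattices in the real line -/

theorem isLattice_span_singleton {ξ : ℝ} (hξ : ξ ≠ 0) :
    IsLattice (Submodule.span ℤ {ξ}) := by
  let b : Module.Basis Unit ℝ ℝ :=
    (Module.Basis.singleton Unit ℝ).unitsSMul (fun _ => Units.mk0 ξ hξ)
  have hb : Set.range b = {ξ} := by
    ext x
    simp [b, Module.Basis.unitsSMul_apply, eq_comm, Units.smul_def]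
  have : IsLattice (Submodule.span ℤ (Set.range b)) :=
    ⟨inferInstance, inferInstance⟩
  rwa [hb] at this

theorem span_singleton_abs (ξ : ℝ) :
    Submodule.span ℤ {|ξ|} = Submodule.span ℤ {ξ} := by
  rcases abs_choice ξ with h | h
  · rw [h]
  · rw [h, ← Set.neg_singleton, Submodule.span_neg]

theorem IsLattice.exists_eq_span_singleton {L : Submodule ℤ ℝ} (hL : IsLattice L) :
    ∃ ξ : ℝ, 0 < ξ ∧ L = Submodule.span ℤ {ξ} := by
  obtain ⟨_, _⟩ := hL
  have := ZLattice.module_finite ℝ L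
  have := ZLattice.module_free ℝ L
  have hr : Module.finrank ℤ L = 1 := by rw [ZLattice.rank ℝ L, Module.finrank_self]
  let b := Module.finBasisOfFinrankEq ℤ L hr
  have hb : Set.range b = {b 0} := by
    ext x; simp [eq_comm]
  have hspan : L = Submodule.span ℤ {(b 0 : ℝ)} := by
    have h1 := congrArg (Submodule.map L.subtype) b.span_eq
    rw [hb, Submodule.map_span, Submodule.map_subtype_top] at h1
    simpa using h1.symm
  refine ⟨|(b 0 : ℝ)|, abs_pos.2 fun h => b.ne_zero 0 (Subtype.ext h), ?_⟩
  rw [span_singleton_abs, ← hspan]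

/-- The integers enumerate the lattice `ξℤ` by `n ↦ nξ`. -/
noncomputable def intEquivSpan {ξ : ℝ} (hξ : ξ ≠ 0) :
    ℤ ≃ ((Submodule.span ℤ {ξ} : Submodule ℤ ℝ) : Set ℝ) :=
  Equiv.ofBijective
    (fun n => ⟨n * ξ, Submodule.mem_span_singleton.2 ⟨n, by simp⟩⟩)
    ⟨fun m n h => by simpa [hξ] using h, fun ⟨x, hx⟩ => by
      obtain ⟨n, rfl⟩ := Submodule.mem_span_singleton.1 hx
      exact ⟨n, by simp⟩⟩

@[simp]
theorem coe_intEquivSpan {ξ : ℝ} (hξ : ξ ≠ 0) (n : ℤ) :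
    (intEquivSpan hξ n : ℝ) = n * ξ := rfl

/-- The points `ξ·0, …, ξ·N` are sent to distinct points of `ξ'ℤ` in an interval of length
`ξN + O(1)`, and there are at most `ξN / ξ' + O(1)` of those. -/
theorem le_of_injective_of_abs_sub_le {ξ ξ' C : ℝ} (hξ : 0 ≤ ξ) (hξ' : 0 < ξ') {φ : ℤ → ℤ}
    (hφ : Function.Injective φ) (hC : ∀ n : ℤ, |n * ξ - φ n * ξ'| ≤ C) : ξ' ≤ ξ := by
  by_contra! hlt
  obtain ⟨N, hN⟩ := exists_nat_gt (2 * C / (ξ' - ξ))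
  rw [div_lt_iff₀ (by linarith)] at hN
  have hsub : (Finset.Icc (0 : ℤ) N).image φ ⊆ Finset.Icc ⌈-C / ξ'⌉ ⌊(N * ξ + C) / ξ'⌋ := by
    intro k hk
    obtain ⟨n, hn, rfl⟩ := Finset.mem_image.1 hk
    obtain ⟨h0, h1⟩ := Finset.mem_Icc.1 hn
    have h0' : (0 : ℝ) ≤ n := by exact_mod_cast h0
    have h1' : (n : ℝ) ≤ N := by exact_mod_cast h1
    have := abs_le.1 (hC n)
    rw [Finset.mem_Icc, Int.ceil_le, Int.le_floor, div_le_iff₀ hξ', le_div_iff₀ hξ']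
    constructor <;> nlinarith
  have hcard := Finset.card_le_card hsub
  rw [Finset.card_image_of_injective _ hφ, Int.card_Icc, Int.card_Icc] at hcard
  have h2 : ((N : ℤ) + 1 : ℤ) ≤ ⌊(N * ξ + C) / ξ'⌋ + 1 - ⌈-C / ξ'⌉ := by omega
  have h3 : (N : ℝ) + 1 ≤ ⌊(N * ξ + C) / ξ'⌋ + 1 - ⌈-C / ξ'⌉ := by exact_mod_cast h2
  have h4 := Int.floor_le ((N * ξ + C) / ξ')
  have h5 := Int.le_ceil (-C / ξ')
  have h6 : (N : ℝ) ≤ (N * ξ + C) / ξ' - (-C / ξ') := by linarith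
  rw [← sub_div, le_div_iff₀ hξ'] at h6
  nlinarith

theorem IsBDLTo.span_singleton_unique {Λ : Set ℝ} {ξ ξ' : ℝ} (hξ : 0 < ξ) (hξ' : 0 < ξ')
    (h : IsBDLTo Λ (Submodule.span ℤ {ξ})) (h' : IsBDLTo Λ (Submodule.span ℤ {ξ'})) :
    ξ = ξ' := by
  obtain ⟨-, -, C, -, g, hg⟩ := h
  obtain ⟨-, -, C', -, g', hg'⟩ := h'
  let φ : ℤ ≃ ℤ :=
    (intEquivSpan hξ.ne').trans (g.symm.trans (g'.trans (intEquivSpan hξ'.ne').symm))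
  have hφ : ∀ n : ℤ, |n * ξ - φ n * ξ'| ≤ C + C' := by
    intro n
    set x := g.symm (intEquivSpan hξ.ne' n) with hx
    have h1 : (g x : ℝ) = n * ξ := by rw [hx, g.apply_symm_apply, coe_intEquivSpan]
    have h2 : (g' x : ℝ) = φ n * ξ' := by
      rw [← coe_intEquivSpan hξ'.ne']; simp [φ, hx]
    have h3 := hg x
    have h4 := hg' x
    rw [Real.dist_eq, h1, abs_lt] at h3
    rw [Real.dist_eq, h2, abs_lt] at h4
    rw [abs_le]
    constructor <;> linarith
  apply le_antisymm
  · refine le_of_injective_of_abs_sub_le hξ'.le hξ φ.symm.injective (C := C + C') fun n => ?_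
    simpa [abs_sub_comm] using hφ (φ.symm n)
  · exact le_of_injective_of_abs_sub_le hξ.le hξ' φ.injective hφ

/-! ### Cocycles with bounded Birkhoff sums -/

section Birkhoff

open MeasureTheory Filter

variable {X : Type*} {T : X → X} {f : X → ℝ} {C : ℝ}

/-- A function with uniformly bounded Birkhoff sums is a coboundary: the upper limit of the
Birkhoff sums is a transfer function. -/
theorem exists_transfer_of_birkhoffSum_bounded [MeasurableSpace X] (hT : Measurable T)
    (hf : Measurable f) (hC : ∀ n x, |birkhoffSum T f n x| ≤ C) :
    ∃ h : X → ℝ, Measurable h ∧ (∀ x, |h x| ≤ C) ∧ ∀ x, h (T x) = h x - f x := by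
  have hle (x : X) : IsBoundedUnder (· ≤ ·) atTop (fun n => birkhoffSum T f n x) :=
    isBoundedUnder_of ⟨C, fun n => (abs_le.1 (hC n x)).2⟩
  have hge (x : X) : IsBoundedUnder (· ≥ ·) atTop (fun n => birkhoffSum T f n x) :=
    isBoundedUnder_of ⟨-C, fun n => (abs_le.1 (hC n x)).1⟩
  refine ⟨fun x => limsup (fun n => birkhoffSum T f n x) atTop, ?_, fun x => ?_, fun x => ?_⟩
  · refine Measurable.limsup fun n => ?_
    unfold birkhoffSum
    exact Finset.measurable_sum _ fun k _ => hf.comp (hT.iterate k)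
  · rw [abs_le]
    constructor
    · exact le_limsup_of_frequently_le
        (Frequently.of_forall fun n => (abs_le.1 (hC n x)).1) (hle x)
    · exact limsup_le_of_le (hge x).isCoboundedUnder_le
        (Eventually.of_forall fun n => (abs_le.1 (hC n x)).2)
  · have h1 : (fun n => birkhoffSum T f n (T x)) =
        fun n => birkhoffSum T f (n + 1) x + -f x := by
      funext n
      rw [birkhoffSum_succ']
      ring
    dsimp only
    rw [h1, limsup_add_const atTop (fun n => birkhoffSum T f (n + 1) x) (-f x),
      limsup_nat_add (fun n => birkhoffSum T f n x) 1, sub_eq_add_neg]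
    · exact isBoundedUnder_of ⟨C, fun n => (abs_le.1 (hC _ x)).2⟩
    · exact (isBoundedUnder_of ⟨-C, fun n => (abs_le.1 (hC _ x)).1⟩ :
        IsBoundedUnder (· ≥ ·) _ _).isCoboundedUnder_le

theorem integral_eq_zero_of_transfer [MeasurableSpace X] {μ : Measure X} [IsFiniteMeasure μ]
    (hT : MeasurePreserving T μ μ) {h : X → ℝ} (hm : Measurable h) (hC : ∀ x, |h x| ≤ C)
    (hf : ∀ x, h (T x) = h x - f x) : ∫ x, f x ∂μ = 0 := by
  have hi : Integrable h μ :=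
    Integrable.of_bound hm.aestronglyMeasurable C (Eventually.of_forall hC)
  have h1 : f = fun x => h x - h (T x) := by
    funext x
    rw [hf]
    ring
  have h2 : ∫ x, h (T x) ∂μ = ∫ x, h x ∂μ := by
    conv_rhs => rw [← hT.map_eq]
    exact (integral_map hT.measurable.aemeasurable hm.aestronglyMeasurable).symm
  rw [h1]
  exact (integral_sub hi (hT.integrable_comp_of_integrable hi)).trans (by
    rw [Function.comp_def, h2, sub_self])

end Birkhoff

/-! ### Eigenvalues of a rotation of the circle -/

section Rotation

open MeasureTheory AddCircle

/-- The eigenvalues of a rotation are the values of the characters at the angle: a nonzero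
Fourier coefficient of an eigenfunction determines the eigenvalue. -/
theorem exists_fourier_eq_of_eigenfunction {α : UnitAddCircle} {F : UnitAddCircle → ℂ} {c : ℂ}
    (hF : Measurable F) (h1 : ∀ x, ‖F x‖ = 1) (hc : ∀ x, F (x + α) = c * F x) :
    ∃ n : ℤ, c = fourier n α := by
  by_contra! hne
  have hzero (n : ℤ) : fourierCoeff F n = 0 := by
    have hshift : fourierCoeff F n = fourier (-n) α * c * fourierCoeff F n := by
      unfold fourierCoeff
      conv_lhs => rw [← integral_add_right_eq_self _ α]
      rw [← integral_const_mul]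
      refine integral_congr_ae (Filter.Eventually.of_forall fun t => ?_)
      simp only [hc, smul_eq_mul, fourier_apply, smul_add, toCircle_add, Circle.coe_mul]
      ring
    by_contra h0
    have h2 : fourier (-n) α * c = 1 := by
      have := mul_right_cancel₀ h0 ((one_mul _).trans hshift)
      exact this.symm
    apply hne n
    calc c = fourier n α * fourier (-n) α * c := by
          rw [← fourier_add, add_neg_cancel, fourier_zero, one_mul]
      _ = fourier n α := by rw [mul_assoc, h2, mul_one]
  have hL : MemLp F 2 (haarAddCircle (T := 1)) :=
    MemLp.of_bound hF.aestronglyMeasurable 1 (Filter.Eventually.of_forall fun x => (h1 x).le)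
  have hP := tsum_sq_fourierCoeff hL.toLp
  rw [fourierCoeff_congr_ae hL.coeFn_toLp] at hP
  have hR : ∫ t, ‖hL.toLp F t‖ ^ 2 ∂(haarAddCircle (T := 1)) = 1 := by
    rw [integral_congr_ae (g := fun _ => (1 : ℝ))]
    · simp
    · filter_upwards [hL.coeFn_toLp] with x hx
      rw [hx, h1, one_pow]
  rw [hR] at hP
  simp [hzero] at hP

/-- The indicator function of the arc `[0, ℓ)` of the circle `ℝ/ℤ`. -/
noncomputable def arc (ℓ : ℝ) (x : UnitAddCircle) : ℝ :=
  if (AddCircle.equivIco 1 0 x : ℝ) < ℓ then 1 else 0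

theorem arc_coe (ℓ x : ℝ) : arc ℓ (x : UnitAddCircle) = if Int.fract x < ℓ then 1 else 0 := by
  have : (AddCircle.equivIco 1 0 (x : UnitAddCircle) : ℝ) = Int.fract x := by
    have h := AddCircle.coe_equivIco_mk_apply (p := (1 : ℝ)) x
    rwa [div_one, mul_one] at h
  rw [arc, this]

theorem measurable_arc (ℓ : ℝ) : Measurable (arc ℓ) :=
  Measurable.ite
    (measurableSet_lt (measurable_subtype_coe.comp (AddCircle.measurableEquivIco 1 0).measurable)
      measurable_const) measurable_const measurable_const

theorem integral_arc {ℓ : ℝ} (h0 : 0 ≤ ℓ) (h1 : ℓ ≤ 1) :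
    ∫ x, arc ℓ x ∂haarAddCircle = ℓ := by
  rw [integral_haarAddCircle, ← UnitAddCircle.intervalIntegral_preimage 0, inv_one, one_smul,
    zero_add, intervalIntegral.integral_of_le zero_le_one, ← integral_Ico_eq_integral_Ioc,
    setIntegral_congr_fun (g := (Set.Ico 0 ℓ).indicator fun _ => (1 : ℝ)) measurableSet_Ico,
    setIntegral_indicator measurableSet_Ico, Set.inter_eq_right.2 (Set.Ico_subset_Ico_right h1)]
  · simp [h0]
  · intro x hx
    simp [arc_coe, Int.fract_eq_self.2 hx, Set.indicator_apply, hx.1]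

/-- **Kesten's theorem**: the frequency of visits of a rotation to the arc `[0, ℓ)` has bounded
discrepancy only if `ℓ` is, modulo `1`, a multiple of the angle. The transfer function `h` of the
cocycle makes `exp(2πih)` an eigenfunction with eigenvalue `exp(2πiθ)`. -/
theorem exists_eq_add_mul_of_birkhoffSum_bounded {ε ℓ θ C : ℝ} (h0 : 0 ≤ ℓ) (h1 : ℓ ≤ 1)
    (hC : ∀ n x, |birkhoffSum (· + (ε : UnitAddCircle)) (fun x => arc ℓ x - θ) n x| ≤ C) :
    ∃ m n : ℤ, ℓ = m + n * ε := by
  obtain ⟨h, hm, hb, hh⟩ := exists_transfer_of_birkhoffSum_bounded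
    (measurable_add_const _) ((measurable_arc ℓ).sub_const θ) hC
  have hint := integral_eq_zero_of_transfer
    (measurePreserving_add_right (haarAddCircle (T := 1)) (ε : UnitAddCircle)) hm hb hh
  have hθ : θ = ℓ := by
    rw [integral_sub, integral_arc h0 h1] at hint
    · simp at hint
      linarith
    · refine Integrable.of_bound (measurable_arc ℓ).aestronglyMeasurable 1
        (Filter.Eventually.of_forall fun x => ?_)
      unfold arc
      split_ifs <;> simp
    · exact integrable_const _
  obtain ⟨n, hn⟩ := exists_fourier_eq_of_eigenfunction (α := (ε : UnitAddCircle))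
    (F := fun x => Complex.exp ((2 * Real.pi * h x : ℝ) * Complex.I))
    (c := Complex.exp ((2 * Real.pi * θ : ℝ) * Complex.I))
    (by fun_prop) (fun x => Complex.norm_exp_ofReal_mul_I _) (fun x => by
      rw [hh]
      unfold arc
      split_ifs
      · rw [← Complex.exp_add, Complex.exp_eq_exp_iff_exists_int]
        exact ⟨-1, by push_cast; ring⟩
      · rw [← Complex.exp_add]
        congr 1
        push_cast
        ring)
  rw [fourier_coe_apply, Complex.exp_eq_exp_iff_exists_int] at hn
  obtain ⟨m, hm⟩ := hn
  refine ⟨m, n, ?_⟩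
  have h2 : ((θ : ℝ) : ℂ) = m + n * ε := by
    have h3 : (2 * Real.pi * Complex.I : ℂ) ≠ 0 := Complex.two_pi_I_ne_zero
    apply mul_left_cancel₀ h3
    push_cast at hm
    rw [div_one] at hm
    linear_combination hm
  rw [← hθ]
  exact_mod_cast h2

end Rotation

/-! ### Parametrizing the cut-and-project set -/

theorem Irrational.exists_int_add_int_mul_mem_Ioo {ε : ℝ} (hε : Irrational ε) {u v : ℝ}
    (huv : u < v) : ∃ m n : ℤ, (m + n * ε : ℝ) ∈ Set.Ioo u v := by
  have hd : Dense (AddSubgroup.closure {1, ε} : Set ℝ) := by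
    rw [Set.pair_comm, dense_addSubgroupClosure_pair_iff]
    simpa using hε
  obtain ⟨x, hx, hxuv⟩ := hd.exists_between huv
  obtain ⟨m, n, rfl⟩ := AddSubgroup.mem_closure_pair.1 hx
  exact ⟨m, n, by simpa using hxuv⟩

/-- The lattice points of the strip over the window are in bijection with the points of the
cut-and-project set, since `η` is irrational. -/
noncomputable def stripEquiv (ε : ℝ) {η : ℝ} (hη : Irrational η) (Ω : Set ℝ) :
    {p : ℤ × ℤ // (p.1 + p.2 * ε : ℝ) ∈ Ω} ≃ cutAndProject ε η Ω :=
  Equiv.ofBijective (fun p => ⟨p.1.1 + p.1.2 * η, p.1.1, p.1.2, rfl, p.2⟩)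
    ⟨fun ⟨⟨a, b⟩, _⟩ ⟨⟨a', b'⟩, _⟩ h => by
      have h' : (a + b * η : ℝ) = a' + b' * η := congrArg Subtype.val h
      have hb : b = b' := by
        by_contra hne
        refine (hη.intCast_mul (sub_ne_zero.2 hne)).ne_int (a' - a) ?_
        push_cast
        linarith
      subst hb
      have ha : a = a' := by exact_mod_cast add_right_cancel h'
      subst ha
      rfl, fun ⟨_, a, b, rfl, h⟩ => ⟨⟨(a, b), h⟩, rfl⟩⟩

theorem coe_stripEquiv (ε : ℝ) {η : ℝ} (hη : Irrational η) (Ω : Set ℝ)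
    (p : {p : ℤ × ℤ // (p.1 + p.2 * ε : ℝ) ∈ Ω}) :
    (stripEquiv ε hη Ω p : ℝ) = (p.1.1 + p.1.2 * ε) + p.1.2 * (η - ε) := by
  change (p.1.1 + p.1.2 * η : ℝ) = _
  ring

/-- Over a window of length at most `1`, a lattice point of the strip is determined by its second
coordinate `b`, which ranges over the times at which the rotation by `ε` started at `-c` visits
the arc `[0, d - c)`. -/
noncomputable def stripEquivVisits (ε : ℝ) {c d : ℝ} (hcd : d - c ≤ 1) :
    {p : ℤ × ℤ // (p.1 + p.2 * ε : ℝ) ∈ Set.Ico c d} ≃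
      {b : ℤ | Int.fract (b * ε - c) < d - c} :=
  Equiv.ofBijective (fun p => ⟨p.1.2, by
      obtain ⟨⟨a, b⟩, h⟩ := p
      have h1 : Int.fract (b * ε - c) = a + b * ε - c := by
        rw [Int.fract_eq_iff]
        exact ⟨by linarith [h.1], by linarith [h.2], -a, by push_cast; ring⟩
      rw [Set.mem_ofPred_eq, h1]
      linarith [h.2]⟩)
    ⟨fun ⟨⟨a, b⟩, h⟩ ⟨⟨a', b'⟩, h'⟩ heq => by
      obtain rfl : b = b' := congrArg Subtype.val heq
      have h1 : (a : ℝ) < a' + 1 := by linarith [h.2, h'.1]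
      have h2 : (a' : ℝ) < a + 1 := by linarith [h.1, h'.2]
      have h3 : a < a' + 1 := by exact_mod_cast h1
      have h4 : a' < a + 1 := by exact_mod_cast h2
      obtain rfl : a = a' := by omega
      rfl, fun ⟨b, hb⟩ => ⟨⟨(-⌊b * ε - c⌋, b), by
        have h1 := Int.self_sub_floor (b * ε - c)
        have h2 := Int.fract_nonneg (b * ε - c)
        have h3 : Int.fract (b * ε - c) < d - c := hb
        push_cast
        constructor <;> linarith⟩, rfl⟩⟩

@[simp]
theorem coe_stripEquivVisits (ε : ℝ) {c d : ℝ} (hcd : d - c ≤ 1)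
    (p : {p : ℤ × ℤ // (p.1 + p.2 * ε : ℝ) ∈ Set.Ico c d}) :
    (stripEquivVisits ε hcd p : ℤ) = p.1.2 := rfl

/-! ### The Delone property -/

section Delone

open Filter Topology

/-- Only finitely many lattice points lie in the parallelogram `|a + bε| < 1`, `|a + bη| < 1`. -/
theorem exists_pos_lt_abs_int_add_int_mul {ε η : ℝ} (hη : Irrational η) (hεη : ε ≠ η) :
    ∃ r : ℝ, 0 < r ∧ ∀ a b : ℤ, (a, b) ≠ (0, 0) → |(a + b * ε : ℝ)| < 1 →
      r < |(a + b * η : ℝ)| := by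
  have hα : 0 < |η - ε| := abs_pos.2 (sub_ne_zero.2 hεη.symm)
  obtain ⟨M, hM⟩ := exists_nat_gt (2 / |η - ε|)
  obtain ⟨K, hK⟩ := exists_nat_gt (1 + M * |ε|)
  let S : Set (ℤ × ℤ) := {p | p ∈ Set.Icc (-K : ℤ) K ×ˢ Set.Icc (-M : ℤ) M ∧ p ≠ (0, 0)}
  have hS : S.Finite := ((Set.finite_Icc _ _).prod (Set.finite_Icc _ _)).subset fun p hp => hp.1
  have hpos : ∀ p ∈ S, ∀ᶠ r in 𝓝[>] (0 : ℝ), r < |(p.1 + p.2 * η : ℝ)| := by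
    intro p hp
    have h0 : 0 < |(p.1 + p.2 * η : ℝ)| := by
      rw [abs_pos]
      intro h
      by_cases hb : p.2 = 0
      · apply hp.2
        rw [hb] at h
        have : p.1 = 0 := by simpa using h
        exact Prod.ext this hb
      · refine (hη.intCast_mul hb).ne_int (-p.1) ?_
        push_cast
        linarith
    exact nhdsWithin_le_nhds (eventually_lt_nhds h0)
  have hlt1 : ∀ᶠ r in 𝓝[>] (0 : ℝ), r < 1 := nhdsWithin_le_nhds (eventually_lt_nhds one_pos)
  have hgt0 : ∀ᶠ r in 𝓝[>] (0 : ℝ), 0 < r := self_mem_nhdsWithin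
  obtain ⟨r, hr, hr1, hr0⟩ :=
    (((eventually_all_finite hS).2 hpos).and (hlt1.and hgt0)).exists
  refine ⟨r, hr0, fun a b hab h1 => ?_⟩
  by_contra! hle
  have hbα : |(b : ℝ)| * |η - ε| < 2 := by
    rw [← abs_mul]
    calc |(b : ℝ) * (η - ε)| = |(a + b * η) - (a + b * ε)| := by ring_nf
      _ ≤ |(a + b * η : ℝ)| + |(a + b * ε : ℝ)| := abs_sub _ _
      _ < 2 := by linarith
  have hb : |(b : ℝ)| ≤ M := ((lt_div_iff₀ hα).2 hbα).le.trans hM.le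
  have ha : |(a : ℝ)| ≤ K := by
    calc |(a : ℝ)| = |(a + b * ε) - b * ε| := by ring_nf
      _ ≤ |(a + b * ε : ℝ)| + |(b : ℝ) * ε| := abs_sub _ _
      _ ≤ 1 + M * |ε| := by
        rw [abs_mul]
        gcongr
      _ ≤ K := hK.le
  rw [abs_le] at ha hb
  refine (hr (a, b) ⟨⟨⟨?_, ?_⟩, ?_, ?_⟩, hab⟩).not_ge hle
  · exact_mod_cast ha.1
  · exact_mod_cast ha.2
  · exact_mod_cast hb.1
  · exact_mod_cast hb.2

/-- Some step `m + nε` of the rotation is positive and shorter than the window, so boundedly many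
repetitions of it lead from any point into the window. -/
theorem exists_dist_cutAndProject_le {ε η c d : ℝ} (hε : Irrational ε) (hεη : ε ≠ η)
    (hc : 0 ≤ c) (hcd : c < d) (hd : d ≤ 1) :
    ∃ R : ℝ, 0 < R ∧ ∀ t : ℝ, ∃ x ∈ cutAndProject ε η (Set.Ico c d), |t - x| ≤ R := by
  obtain ⟨m, n, hδ0, hδℓ⟩ := hε.exists_int_add_int_mul_mem_Ioo (sub_pos.2 hcd)
  set δ : ℝ := m + n * ε with hδ
  have hα : η - ε ≠ 0 := sub_ne_zero.2 hεη.symm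
  refine ⟨1 + |η - ε| + (1 / δ + 1) * |n * (η - ε)|, by positivity, fun t => ?_⟩
  set b : ℤ := ⌊t / (η - ε)⌋ with hb
  set a : ℤ := ⌈c - b * ε⌉ - 1 with ha
  set k : ℤ := ⌈(c - (a + b * ε)) / δ⌉ with hk
  have ha1 : (a + b * ε : ℝ) < c := by
    have := Int.ceil_lt_add_one (c - b * ε)
    rw [ha]; push_cast; linarith
  have ha2 : c - 1 ≤ (a + b * ε : ℝ) := by
    have := Int.le_ceil (c - b * ε)
    rw [ha]; push_cast; linarith
  have hk1 : c - (a + b * ε) ≤ k * δ := (div_le_iff₀ hδ0).1 (Int.le_ceil _)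
  have hk2 : (k - 1) * δ < c - (a + b * ε) :=
    (lt_div_iff₀ hδ0).1 (by linarith [Int.ceil_lt_add_one ((c - (a + b * ε)) / δ)])
  have hk0 : (0 : ℝ) ≤ k := by
    by_contra! h
    nlinarith
  have hk3 : (k : ℝ) ≤ 1 / δ + 1 := by
    rw [← sub_le_iff_le_add, le_div_iff₀ hδ0]
    linarith
  have hy : (a + b * ε + k * δ : ℝ) ∈ Set.Ico c d := ⟨by linarith, by linarith⟩
  refine ⟨(a + b * ε + k * δ) + (b + k * n) * (η - ε), ⟨a + k * m, b + k * n, ?_, ?_⟩, ?_⟩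
  · push_cast; rw [hδ]; ring
  · convert hy using 1; push_cast; rw [hδ]; ring
  · have hfr : |t - b * (η - ε)| ≤ |η - ε| := by
      have h1 : t - b * (η - ε) = Int.fract (t / (η - ε)) * (η - ε) := by
        rw [← Int.self_sub_floor, ← hb]
        field_simp
      rw [h1, abs_mul, Int.abs_fract]
      exact mul_le_of_le_one_left (abs_nonneg _) (Int.fract_lt_one _).le
    have hkn : |k * (n * (η - ε))| ≤ (1 / δ + 1) * |n * (η - ε)| := by
      rw [abs_mul, abs_of_nonneg hk0]
      gcongr
    rw [abs_le] at hfr hkn ⊢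
    constructor <;> linarith [hy.1, hy.2]

theorem isDelone_cutAndProject {ε η c d : ℝ} (hε : Irrational ε) (hη : Irrational η)
    (hεη : ε ≠ η) (hc : 0 ≤ c) (hcd : c < d) (hd : d ≤ 1) :
    IsDelone (cutAndProject ε η (Set.Ico c d)) := by
  obtain ⟨r, hr0, hr⟩ := exists_pos_lt_abs_int_add_int_mul hη hεη
  obtain ⟨R, hR0, hR⟩ := exists_dist_cutAndProject_le hε hεη hc hcd hd
  refine ⟨⟨cutAndProject ε η (Set.Ico c d), r.toNNReal,
    Real.toNNReal_pos.2 hr0, ?_, R.toNNReal, Real.toNNReal_pos.2 hR0, ?_⟩, rfl⟩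
  · rintro _ ⟨a, b, rfl, h⟩ _ ⟨a', b', rfl, h'⟩ hne
    have h1 := hr (a - a') (b - b') (fun h0 => hne (by
      rw [Prod.mk.injEq, sub_eq_zero, sub_eq_zero] at h0
      rw [h0.1, h0.2])) (by
        rw [abs_lt]
        push_cast
        constructor <;> linarith [h.1, h.2, h'.1, h'.2])
    change ENNReal.ofReal r < _
    rw [edist_dist, ENNReal.ofReal_lt_ofReal_iff_of_nonneg hr0.le, Real.dist_eq]
    convert h1 using 2
    push_cast
    ring
  · intro t _
    obtain ⟨x, hx, hxt⟩ := hR t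
    refine ⟨x, hx, ?_⟩
    change edist t x ≤ ENNReal.ofReal R
    rw [edist_dist, Real.dist_eq]
    exact ENNReal.ofReal_le_ofReal hxt

end Delone

/-! ### Windows of length in `ℤ + ℤε` -/

/-- Every orbit of the translation of `ℤ²` by `(m, n) = (g m', g n')` meets the strip over
`[c, c + m + nε)` exactly once. Orbits are enumerated by `g (m'b - n'a) + ((ua + vb) mod g)`,
where `u m' + v n' = 1`. -/
theorem exists_stripEquiv_int {ε c d : ℝ} (hcd : c < d) {m n : ℤ} (hmn : d - c = m + n * ε) :
    ∃ (r : ℝ) (f : {p : ℤ × ℤ // (p.1 + p.2 * ε : ℝ) ∈ Set.Ico c d} ≃ ℤ),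
      ∀ p, |(m * p.1.2 - n * p.1.1 - f p : ℝ)| ≤ r := by
  have hg : (0 : ℤ) < Int.gcd m n := by
    have : Int.gcd m n ≠ 0 := by
      rw [Ne, Int.gcd_eq_zero_iff]
      rintro ⟨rfl, rfl⟩
      simp at hmn
      linarith
    omega
  obtain ⟨m', hm'⟩ := Int.gcd_dvd_left (a := m) (b := n)
  obtain ⟨n', hn'⟩ := Int.gcd_dvd_right (a := m) (b := n)
  have hbez := Int.gcd_eq_gcd_ab m n
  set g : ℤ := (Int.gcd m n : ℤ)
  set u := Int.gcdA m n
  set v := Int.gcdB m n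
  have huv : u * m' + v * n' = 1 := by
    apply mul_left_cancel₀ hg.ne'
    linear_combination (-hbez) - u * hm' - v * hn'
  let F : {p : ℤ × ℤ // (p.1 + p.2 * ε : ℝ) ∈ Set.Ico c d} → ℤ :=
    fun p => (u * p.1.1 + v * p.1.2) % g + g * (m' * p.1.2 - n' * p.1.1)
  have hdiv (p) : F p / g = m' * p.1.2 - n' * p.1.1 := by
    simp only [F]
    rw [Int.add_mul_ediv_left _ _ hg.ne',
      Int.ediv_eq_zero_of_lt (Int.emod_nonneg _ hg.ne') (Int.emod_lt_of_pos _ hg), zero_add]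
  have hmod (p) : F p % g = (u * p.1.1 + v * p.1.2) % g := by
    simp only [F]
    rw [Int.add_mul_emod_self_left, Int.emod_emod]
  have hinj : Function.Injective F := by
    rintro ⟨⟨a, b⟩, h⟩ ⟨⟨a', b'⟩, h'⟩ heq
    have h1 := congrArg (· / g) heq
    have h2 := congrArg (· % g) heq
    simp only [hdiv] at h1
    simp only [hmod] at h2
    obtain ⟨t, ht⟩ := (Int.ModEq.dvd h2 : g ∣ _)
    have hA : a' - a = m * t := by
      linear_combination m' * ht - t * hm' + v * h1 - (a' - a) * huv
    have hB : b' - b = n * t := by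
      linear_combination n' * ht - t * hn' - u * h1 - (b' - b) * huv
    have hA' : (a' - a : ℝ) = m * t := by exact_mod_cast hA
    have hB' : (b' - b : ℝ) = n * t := by exact_mod_cast hB
    -- the two points of the window differ by `t` times its length
    have hy : (a' + b' * ε) - (a + b * ε) = t * (d - c) := by
      linear_combination hA' + ε * hB' - t * hmn
    have ht1 : (t : ℝ) < 1 := by
      by_contra! hle
      nlinarith [h.1, h'.2]
    have ht2 : (-1 : ℝ) < t := by
      by_contra! hle
      nlinarith [h.2, h'.1]
    have ht3 : t < 1 := by exact_mod_cast ht1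
    have ht4 : -1 < t := by exact_mod_cast ht2
    obtain rfl : t = 0 := by omega
    rw [mul_zero, sub_eq_zero] at hA hB
    subst hA hB
    rfl
  have hsurj : Function.Surjective F := by
    intro k
    set q := k / g with hq
    set p := k % g with hp
    set a := m' * p - v * q with ha
    set b := n' * p + u * q with hb
    set s : ℤ := ⌊(a + b * ε - c) / (d - c)⌋ with hs
    have hℓ : 0 < d - c := sub_pos.2 hcd
    have hs1 : s * (d - c) ≤ a + b * ε - c := (le_div_iff₀ hℓ).1 (Int.floor_le _)
    have hs2 : a + b * ε - c < (s + 1) * (d - c) := (div_lt_iff₀ hℓ).1 (Int.lt_floor_add_one _)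
    have hy : ((a - s * m : ℤ) + (b - s * n : ℤ) * ε : ℝ) = a + b * ε - s * (d - c) := by
      push_cast
      linear_combination s * hmn
    refine ⟨⟨(a - s * m, b - s * n), ?_⟩, ?_⟩
    · change (((a - s * m : ℤ) : ℝ) + ((b - s * n : ℤ) : ℝ) * ε) ∈ Set.Ico c d
      rw [hy]
      constructor <;> linarith
    · have h1 : u * (a - s * m) + v * (b - s * n) = p + g * (-s) := by
        linear_combination u * ha + v * hb - s * u * hm' - s * v * hn' + (p - g * s) * huv
      have h2 : m' * (b - s * n) - n' * (a - s * m) = q := by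
        linear_combination m' * hb - n' * ha - s * m' * hn' + s * n' * hm' + q * huv
      change (u * (a - s * m) + v * (b - s * n)) % g +
        g * (m' * (b - s * n) - n' * (a - s * m)) = k
      rw [h1, h2, Int.add_mul_emod_self_left, hp, Int.emod_emod, hq]
      exact Int.emod_add_mul_ediv k g
  refine ⟨g, Equiv.ofBijective F ⟨hinj, hsurj⟩, fun p => ?_⟩
  have h1 : m * p.1.2 - n * p.1.1 - F p = -((u * p.1.1 + v * p.1.2) % g) := by
    simp only [F]
    linear_combination p.1.2 * hm' - p.1.1 * hn'
  have h2 : |m * p.1.2 - n * p.1.1 - F p| ≤ g := by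
    rw [h1, abs_neg, abs_of_nonneg (Int.emod_nonneg _ hg.ne')]
    exact (Int.emod_lt_of_pos _ hg).le
  change |(m * p.1.2 - n * p.1.1 - F p : ℝ)| ≤ (g : ℝ)
  exact_mod_cast h2

/-- With `y = a + bε` in the window, `mb - na = b(d - c) - ny`, so the enumeration of the strip
is a bounded perturbation of `b(d - c)`, whereas `a + bη` is one of `b(η - ε)`. -/
theorem boundedDistEquiv_cutAndProject {ε η c d : ℝ} (hη : Irrational η) (hεη : ε ≠ η)
    (hc : 0 ≤ c) (hcd : c < d) (hd : d ≤ 1) (h : ∃ m n : ℤ, d - c = m + n * ε) :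
    BoundedDistEquiv (cutAndProject ε η (Set.Ico c d))
      (Submodule.span ℤ {|η - ε| / (d - c)} : Submodule ℤ ℝ) := by
  obtain ⟨m, n, hmn⟩ := h
  obtain ⟨r, f, hf⟩ := exists_stripEquiv_int hcd hmn
  have hℓ : 0 < d - c := sub_pos.2 hcd
  set κ := (η - ε) / (d - c) with hκ
  have hκ0 : κ ≠ 0 := div_ne_zero (sub_ne_zero.2 hεη.symm) hℓ.ne'
  have hκα : κ * (d - c) = η - ε := div_mul_cancel₀ _ hℓ.ne'
  have hspan : Submodule.span ℤ {|η - ε| / (d - c)} = Submodule.span ℤ {κ} := by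
    rw [← span_singleton_abs κ, hκ, abs_div, abs_of_pos hℓ]
  rw [hspan]
  have hr : 0 ≤ r := (abs_nonneg _).trans (hf (f.symm 0))
  refine ⟨2 + |n * κ| + r * |κ|, by positivity,
    (stripEquiv ε hη _).symm.trans (f.trans (intEquivSpan hκ0)), fun x => ?_⟩
  obtain ⟨p, rfl⟩ := (stripEquiv ε hη _).surjective x
  simp only [Equiv.trans_apply, Equiv.symm_apply_apply]
  rw [coe_stripEquiv, coe_intEquivSpan, Real.dist_eq]
  have hp := p.2
  set y : ℝ := p.1.1 + p.1.2 * ε with hy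
  have hy1 : |y| ≤ 1 := abs_le.2 ⟨by linarith [hp.1], by linarith [hp.2]⟩
  have hsplit : y + p.1.2 * (η - ε) - f p * κ =
      y + n * κ * y + (m * p.1.2 - n * p.1.1 - f p) * κ := by
    rw [← hκα, hmn, hy]
    ring
  rw [hsplit]
  calc |y + n * κ * y + (m * p.1.2 - n * p.1.1 - f p) * κ|
      ≤ |y| + |n * κ * y| + |(m * p.1.2 - n * p.1.1 - f p) * κ| := abs_add_three _ _ _
    _ ≤ 1 + |n * κ| * 1 + r * |κ| := by
      rw [abs_mul (n * κ), abs_mul (m * p.1.2 - n * p.1.1 - f p : ℝ)]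
      gcongr
      exact hf p
    _ < 2 + |n * κ| + r * |κ| := by linarith

/-! ### Bounded discrepancy of the visits -/

section Discrepancy

open Filter Topology

/-- If a set of integers is enumerated by `φ` with `bθ = φ b + O(1)`, then its number of points in
an interval of length `N` is `Nθ + O(1)`, uniformly in the position of the interval. -/
theorem abs_card_sub_mul_le {B : Set ℤ} [DecidablePred (· ∈ B)] (φ : B ≃ ℤ) {θ C : ℝ}
    (hθ : 0 < θ) (hφ : ∀ b : B, |(b : ℤ) * θ - φ b| ≤ C) (p : ℤ) (N : ℕ) :
    |(((Finset.Ico p (p + N)).filter (· ∈ B)).card - N * θ : ℝ)| ≤ 2 * C + 1 := by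
  have hC : 0 ≤ C := (abs_nonneg _).trans (hφ (φ.symm 0))
  have hN : 0 ≤ N * θ := by positivity
  let ψ : ℤ → ℤ := fun k => φ.symm k
  have hψ : Function.Injective ψ := Subtype.val_injective.comp φ.symm.injective
  have hψC (k : ℤ) : |ψ k * θ - k| ≤ C := by simpa [ψ] using hφ (φ.symm k)
  have hupper : (Finset.Ico p (p + N)).filter (· ∈ B) ⊆
      (Finset.Icc ⌈p * θ - C⌉ ⌊(p + N) * θ + C⌋).image ψ := by
    intro b hb
    rw [Finset.mem_filter, Finset.mem_Ico] at hb
    obtain ⟨⟨h0, h1⟩, hB⟩ := hb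
    have h0' : (p : ℝ) ≤ b := by exact_mod_cast h0
    have h1' : (b : ℝ) ≤ p + N := by exact_mod_cast h1.le
    have h2 := abs_le.1 (hφ ⟨b, hB⟩)
    refine Finset.mem_image.2 ⟨φ ⟨b, hB⟩, ?_, by simp [ψ]⟩
    rw [Finset.mem_Icc, Int.ceil_le, Int.le_floor]
    constructor <;> nlinarith
  have hlower : (Finset.Ico ⌈p * θ + C⌉ ⌈(p + N) * θ - C⌉).image ψ ⊆
      (Finset.Ico p (p + N)).filter (· ∈ B) := by
    intro b hb
    obtain ⟨k, hk, rfl⟩ := Finset.mem_image.1 hb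
    rw [Finset.mem_Ico, Int.ceil_le, Int.lt_ceil] at hk
    have h2 := abs_le.1 (hψC k)
    have h3 : (p : ℝ) ≤ ψ k := le_of_mul_le_mul_right (by linarith [hk.1]) hθ
    have h4 : (ψ k : ℝ) < p + N := lt_of_mul_lt_mul_right (by linarith [hk.2]) hθ.le
    rw [Finset.mem_filter, Finset.mem_Ico]
    exact ⟨⟨by exact_mod_cast h3, by exact_mod_cast h4⟩, (φ.symm k).2⟩
  have hu := Finset.card_le_card hupper
  have hl := Finset.card_le_card hlower
  rw [Finset.card_image_of_injective _ hψ, Int.card_Icc] at hu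
  rw [Finset.card_image_of_injective _ hψ, Int.card_Ico] at hl
  set S := ((Finset.Ico p (p + N)).filter (· ∈ B)).card
  have h1 := Int.floor_le ((p + N) * θ + C)
  have h2 := Int.le_ceil (p * θ - C)
  have h3 := Int.ceil_lt_add_one (p * θ + C)
  have h4 := Int.le_ceil ((p + N) * θ - C)
  have hl' : ⌈(p + N) * θ - C⌉ - ⌈p * θ + C⌉ ≤ (S : ℤ) := by omega
  have hl'' : (⌈(p + N) * θ - C⌉ - ⌈p * θ + C⌉ : ℝ) ≤ S := by exact_mod_cast hl'
  have hu'' : (S : ℝ) ≤ N * θ + 2 * C + 1 := by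
    rcases le_total (⌊(p + N) * θ + C⌋ + 1 - ⌈p * θ - C⌉) 0 with hneg | hpos
    · rw [Int.toNat_of_nonpos hneg, Nat.le_zero] at hu
      rw [hu, Nat.cast_zero]
      positivity
    · have : (S : ℤ) ≤ ⌊(p + N) * θ + C⌋ + 1 - ⌈p * θ - C⌉ := by omega
      have : (S : ℝ) ≤ ⌊(p + N) * θ + C⌋ + 1 - ⌈p * θ - C⌉ := by exact_mod_cast this
      linarith
  rw [abs_le]
  constructor <;> linarith

theorem birkhoffSum_arc_coe (ε ℓ θ x : ℝ) (N : ℕ) :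
    birkhoffSum (· + (ε : UnitAddCircle)) (fun y => arc ℓ y - θ) N (x : UnitAddCircle) =
      ((Finset.range N).filter fun k : ℕ => Int.fract (x + k * ε) < ℓ).card - N * θ := by
  have h (k : ℕ) : arc ℓ ((· + (ε : UnitAddCircle))^[k] (x : UnitAddCircle)) =
      if Int.fract (x + k * ε) < ℓ then 1 else 0 := by
    rw [add_right_iterate, ← arc_coe]
    congr 1
    rw [← nsmul_eq_mul, AddCircle.coe_add, AddCircle.coe_nsmul]
  simp only [birkhoffSum, h, Finset.sum_sub_distrib, Finset.sum_boole, Finset.sum_const,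
    Finset.card_range, nsmul_eq_mul]

theorem eventually_fract_lt_iff (x ℓ : ℝ) :
    ∀ᶠ y in 𝓝[≥] x, (Int.fract y < ℓ ↔ Int.fract x < ℓ) := by
  have hfl : ∀ᶠ y in 𝓝[≥] x, ⌊y⌋ = ⌊x⌋ :=
    tendsto_pure.1 (tendsto_floor_right_pure_floor x)
  by_cases hx : Int.fract x < ℓ
  · have hlt : ∀ᶠ y in 𝓝[≥] x, y < ⌊x⌋ + ℓ :=
      nhdsWithin_le_nhds (eventually_lt_nhds (by rw [← Int.self_sub_floor] at hx; linarith))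
    filter_upwards [hfl, hlt] with y h1 h2
    simp only [hx, iff_true]
    rw [← Int.self_sub_floor, h1]
    linarith
  · filter_upwards [hfl, self_mem_nhdsWithin] with y h1 h2
    have h2' : x ≤ y := h2
    simp only [hx, iff_false, not_lt]
    rw [not_lt, ← Int.self_sub_floor] at hx
    rw [← Int.self_sub_floor, h1]
    linarith

/-- The number of visits in finite time is unchanged by moving the starting point slightly to the
right, so it is attained on any given orbit, the orbits being dense. -/
theorem exists_birkhoffSum_arc_eq {ε : ℝ} (hε : Irrational ε) (c ℓ θ : ℝ) (N : ℕ)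
    (x : UnitAddCircle) : ∃ p : ℤ,
      birkhoffSum (· + (ε : UnitAddCircle)) (fun y => arc ℓ y - θ) N x =
        birkhoffSum (· + (ε : UnitAddCircle)) (fun y => arc ℓ y - θ) N
          ((p * ε - c : ℝ) : UnitAddCircle) := by
  obtain ⟨x, rfl⟩ := QuotientAddGroup.mk_surjective x
  have hev : ∀ᶠ y in 𝓝[≥] x, ∀ k ∈ Finset.range N,
      (Int.fract (y + k * ε) < ℓ ↔ Int.fract (x + k * ε) < ℓ) := by
    rw [Filter.eventually_all_finset]
    intro k _
    have ht : Tendsto (fun y => y + k * ε) (𝓝[≥] x) (𝓝[≥] (x + k * ε)) := by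
      refine tendsto_nhdsWithin_of_tendsto_nhds_of_eventually_within _
        (((continuous_add_const (k * ε)).tendsto x).mono_left nhdsWithin_le_nhds) ?_
      filter_upwards [self_mem_nhdsWithin] with y hy
      have hy' : x ≤ y := hy
      exact add_le_add_left hy' _
    exact ht.eventually (eventually_fract_lt_iff _ _)
  obtain ⟨v, hv, hsub⟩ := mem_nhdsGE_iff_exists_Ico_subset.1 hev
  obtain ⟨m, p, hmp⟩ := hε.exists_int_add_int_mul_mem_Ioo
    (add_lt_add_left (Set.mem_Ioi.1 hv) c)
  have hy : (m + p * ε - c : ℝ) ∈ Set.Ico x v := ⟨by linarith [hmp.1], by linarith [hmp.2]⟩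
  have hcoe : ((p * ε - c : ℝ) : UnitAddCircle) = ((m + p * ε - c : ℝ) : UnitAddCircle) := by
    have hm : ((m : ℝ) : UnitAddCircle) = 0 := by
      rw [AddCircle.coe_eq_zero_iff]
      exact ⟨m, by simp⟩
    rw [add_sub_assoc, AddCircle.coe_add, hm, zero_add]
  refine ⟨p, ?_⟩
  rw [hcoe]
  rw [birkhoffSum_arc_coe, birkhoffSum_arc_coe]
  congr 3
  exact Finset.filter_congr fun k hk => (hsub hy k hk).symm

/-- A bounded distance equivalence with a lattice enumerates the visits `b` of the rotation to the
arc with bounded error, hence bounds all Birkhoff sums of the arc, and Kesten's theorem applies. -/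
theorem exists_eq_add_mul_of_isBDL {ε η c d : ℝ} (hε : Irrational ε) (hη : Irrational η)
    (hεη : ε ≠ η) (hc : 0 ≤ c) (hcd : c < d) (hd : d ≤ 1)
    (h : IsBDL (cutAndProject ε η (Set.Ico c d))) : ∃ m n : ℤ, d - c = m + n * ε := by
  classical
  obtain ⟨L, -, hL, C, hC, g, hg⟩ := h
  obtain ⟨ξ, hξ, rfl⟩ := hL.exists_eq_span_singleton
  have hℓ1 : d - c ≤ 1 := by linarith
  set B : Set ℤ := {b : ℤ | Int.fract (b * ε - c) < d - c} with hB
  let φ : B ≃ ℤ := (stripEquivVisits ε hℓ1).symm.trans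
    ((stripEquiv ε hη _).trans (g.trans (intEquivSpan hξ.ne').symm))
  have hφ (b : B) : |(b : ℤ) * ((η - ε) / ξ) - φ b| ≤ (C + 1) / ξ := by
    obtain ⟨p, rfl⟩ := (stripEquivVisits ε hℓ1).surjective b
    have h1 := hg (stripEquiv ε hη _ p)
    have h2 : (g (stripEquiv ε hη _ p) : ℝ) = φ (stripEquivVisits ε hℓ1 p) * ξ := by
      rw [← coe_intEquivSpan hξ.ne']
      simp [φ]
    rw [h2, coe_stripEquiv, Real.dist_eq, abs_lt] at h1
    have hp := p.2
    rw [coe_stripEquivVisits, le_div_iff₀ hξ, ← abs_of_pos hξ, ← abs_mul, abs_of_pos hξ,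
      sub_mul, mul_assoc, div_mul_cancel₀ _ hξ.ne', abs_le]
    constructor <;> linarith [hp.1, hp.2]
  -- reversing the enumeration if necessary makes the density positive
  obtain ⟨φ', hφ'⟩ : ∃ φ' : B ≃ ℤ,
      ∀ b : B, |(b : ℤ) * |(η - ε) / ξ| - φ' b| ≤ (C + 1) / ξ := by
    rcases abs_choice ((η - ε) / ξ) with h | h
    · exact ⟨φ, by rwa [h]⟩
    · refine ⟨φ.trans (Equiv.neg ℤ), fun b => ?_⟩
      rw [h, Equiv.trans_apply, Equiv.neg_apply, Int.cast_neg, ← abs_neg]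
      convert hφ b using 2
      ring
  have hθ : 0 < |(η - ε) / ξ| := abs_pos.2 (div_ne_zero (sub_ne_zero.2 hεη.symm) hξ.ne')
  refine exists_eq_add_mul_of_birkhoffSum_bounded (θ := |(η - ε) / ξ|)
    (C := 2 * ((C + 1) / ξ) + 1) (by linarith) hℓ1 fun N x => ?_
  obtain ⟨p, hp⟩ := exists_birkhoffSum_arc_eq hε c (d - c) |(η - ε) / ξ| N x
  rw [hp, birkhoffSum_arc_coe]
  convert abs_card_sub_mul_le φ' hθ hφ' p N using 4
  refine Finset.card_nbij' (fun k : ℕ => p + k) (fun b => (b - p).toNat) ?_ ?_ ?_ ?_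
  · intro k hk
    simp only [Finset.coe_filter, Finset.mem_range, Set.mem_ofPred_eq, Finset.mem_Ico, hB]
      at hk ⊢
    refine ⟨by omega, ?_⟩
    convert hk.2 using 2
    push_cast
    ring
  · intro b hb
    simp only [Finset.coe_filter, Finset.mem_range, Set.mem_ofPred_eq, Finset.mem_Ico, hB]
      at hb ⊢
    refine ⟨by omega, ?_⟩
    have h1 : (((b - p).toNat : ℤ) : ℝ) = b - p := by
      rw [Int.toNat_of_nonneg (by omega)]
      push_cast
      ring
    rw [Int.cast_natCast] at h1
    convert hb.2 using 2
    rw [h1]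
    ring
  · intro k _
    simp
  · intro b hb
    simp only [Finset.coe_filter, Set.mem_ofPred_eq, Finset.mem_Ico] at hb
    dsimp only
    omega

end Discrepancy

/-! ### The equivalence and the lattice -/

theorem mainTheorem4 (ε η c d : ℝ) (hε : Irrational ε) (hη : Irrational η)
    (hε01 : ε ∈ Set.Ioo (0 : ℝ) 1) (hεη : ε ≠ η)
    (hc : 0 ≤ c) (hcd : c < d) (hd : d ≤ 1) :
    IsDelone (cutAndProject ε η (Set.Ico c d)) ∧
    (IsBDL (cutAndProject ε η (Set.Ico c d)) ↔ ∃ m n : ℤ, d - c = m + n * ε) ∧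
    ((∃ m n : ℤ, d - c = m + n * ε) →
      IsBDLTo (cutAndProject ε η (Set.Ico c d)) (Submodule.span ℤ {|η - ε| / (d - c)}) ∧
      ∀ L : Submodule ℤ ℝ, IsBDLTo (cutAndProject ε η (Set.Ico c d)) L →
        L = Submodule.span ℤ {|η - ε| / (d - c)}) := by
  have hDelone := isDelone_cutAndProject hε hη hεη hc hcd hd
  have hpos : 0 < |η - ε| / (d - c) :=
    div_pos (abs_pos.2 (sub_ne_zero.2 hεη.symm)) (sub_pos.2 hcd)
  have hBDL (h : ∃ m n : ℤ, d - c = m + n * ε) :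
      IsBDLTo (cutAndProject ε η (Set.Ico c d)) (Submodule.span ℤ {|η - ε| / (d - c)}) :=
    ⟨hDelone, isLattice_span_singleton hpos.ne',
      boundedDistEquiv_cutAndProject hη hεη hc hcd hd h⟩
  refine ⟨hDelone, ⟨exists_eq_add_mul_of_isBDL hε hη hεη hc hcd hd, fun h => ⟨_, hBDL h⟩⟩,
    fun h => ⟨hBDL h, fun L hL => ?_⟩⟩
  obtain ⟨ξ, hξ, rfl⟩ := hL.2.1.exists_eq_span_singleton
  rw [hL.span_singleton_unique hξ hpos (hBDL h)]
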